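/- A cycle set is a set $X$ with a binary operation $\cdot$ such that every left multiplication $\sigma_x : X\to X$, $y\mapsto x\cdot y$, is bijective and $(x\cdot y)\cdot(x\cdot z)=(y\cdot x)\cdot(y\cdot z)$ for all $x,y,z\in X$. It is non-degenerate if the squaring map $x\mapsto x\cdot x$ is bijective. Its permutation group $\mathcal{G}(X)$ is the subgroup of $\mathrm{Sym}(X)$ generated by $\{\sigma_x : x\in X\}$; $X$ is called indecomposable if $\mathcal{G}(X)$ acts transitively on $X$, and decomposable otherwise. For a positive integer $n$ let $\pi(n)$ be the set of primes dividing $n$, and let $o(g)$ denote the order of a group element $g$. Let $X$ be a finite non-degenerate cycle set whose permutation group $\mathcal{G}(X)$ is nilpotent. (1) If $X$ is indecomposable, then for every $x\in X$ $$\pi(o(\sigma_x))=\pi(|X|)=\pi(|\mathcal{G}(X)|).$$ (2) If there is an $x\in X$ such that $\pi(o(\sigma_x))\neq\pi(|X|)$ or $\pi(o(\sigma_x))\neq\pi(|\mathcal{G}(X)|)$, then $X$ is decomposable. -/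

import Mathlib

/-- A cycle set: a set `X` with a binary operation, written `*` here, such that every left
multiplication `y ↦ x * y` is bijective and the cycloid equation
`(x * y) * (x * z) = (y * x) * (y * z)` holds. -/
class CycleSet (X : Type*) extends Mul X where
  bijective_mul_left : ∀ x : X, Function.Bijective (fun y : X => x * y)
  cycloid : ∀ x y z : X, (x * y) * (x * z) = (y * x) * (y * z)

namespace CycleSet

/-- The cycle set is non-degenerate: the squaring map `T : x ↦ x * x` is bijective. -/
def IsNondegenerate (X : Type*) [CycleSet X] : Prop :=
  Function.Bijective (fun x : X => x * x)

/-- The left multiplication `σ x : y ↦ x * y`, as a permutation of `X`. -/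
noncomputable def σ {X : Type*} [CycleSet X] (x : X) : Equiv.Perm X :=
  Equiv.ofBijective (fun y : X => x * y) (bijective_mul_left x)

/-- The associated permutation group `𝒢(X)`, generated by all `σ x` inside `Sym(X)`. -/
def permGroup (X : Type*) [CycleSet X] : Subgroup (Equiv.Perm X) :=
  Subgroup.closure (Set.range (σ : X → Equiv.Perm X))

/-- `X` is indecomposable if `𝒢(X)` acts transitively on `X`
(by the natural action of permutations). -/
def IsIndecomposable (X : Type*) [CycleSet X] : Prop :=
  MulAction.IsPretransitive (permGroup X) X

/-- `X` is decomposable if it is not indecomposable. -/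
def IsDecomposable (X : Type*) [CycleSet X] : Prop :=
  ¬ IsIndecomposable X

end CycleSet

/-! Extending `σ` to multisets turns 𝒢(X) into a brace: `permOf` identifies it with a finite abelian
group on which 𝒢(X) acts by automorphisms. Hence the additive `n`-torsion is also a subgroup for
composition, of the same order. If a prime `p` divides |𝒢(X)| but not `o(σ x)`, split `x` additively
into a `p`-part and a `p'`-part; this writes `σ x` as a `p`-element times a `p'`-element. Nilpotency
kills the `p`-element, so `x` is additively `p'`-torsion, and by transitivity so is every generator,
contradicting `p ∣ |𝒢(X)|`. The primes of |X| and |𝒢(X)| agree since a normal Sylow subgroup with a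
fixed point acts trivially. -/

namespace Group

/-- In a finite nilpotent group, a `p`-element `b` is trivial as soon as `a` and `b * a` have order
prime to `p`. -/
theorem eq_one_of_isNilpotent_of_coprime_orderOf {G : Type*} [Group G] [Finite G]
    (hG : IsNilpotent G) {p k : ℕ} (hp : p.Prime) {a b : G} (hb : b ^ p ^ k = 1)
    (ha : p.Coprime (orderOf a)) (hba : p.Coprime (orderOf (b * a))) : b = 1 := by
  have key : ∀ {Q : Type _} [Group Q] {q : ℕ}, IsPGroup q Q → ∀ x : Q,
      q.Coprime (orderOf x) → x = 1 := by
    intro Q _ q hQ x hx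
    obtain ⟨n, hn⟩ := hQ x
    rw [← orderOf_eq_one_iff]
    exact Nat.Coprime.eq_one_of_dvd (hx.symm.pow_right n) (orderOf_dvd_of_pow_eq_one hn)
  obtain ⟨e⟩ := (isNilpotent_of_finite_tfae (G := G).out 0 4).mp hG
  apply e.symm.injective
  rw [map_one]
  -- 𝒢 is the product of its Sylow subgroups, so `b` can be tested in each factor.
  funext q Q
  let f : G →* (Q : Subgroup G) :=
    ((Pi.evalMonoidHom _ Q).comp (Pi.evalMonoidHom _ q)).comp e.symm.toMonoidHom
  change f b = 1
  have hq : (q : ℕ).Prime := Nat.prime_of_mem_primeFactors q.2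
  by_cases hqp : (q : ℕ) = p
  · have h1 : f a = 1 := key Q.isPGroup' _
      (Nat.Coprime.coprime_dvd_right (orderOf_map_dvd f a) (hqp ▸ ha))
    have h2 : f (b * a) = 1 := key Q.isPGroup' _
      (Nat.Coprime.coprime_dvd_right (orderOf_map_dvd f _) (hqp ▸ hba))
    rwa [map_mul, h1, mul_one] at h2
  · refine key Q.isPGroup' _ (Nat.Coprime.coprime_dvd_right
      ((orderOf_map_dvd f b).trans (orderOf_dvd_of_pow_eq_one hb)) ?_)
    exact ((Nat.coprime_primes hq hp).mpr hqp).pow_right k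

/-- A finite nilpotent group acting faithfully and transitively has order divisible only by the
primes dividing the degree. -/
theorem dvd_card_of_isNilpotent_of_isPretransitive {G α : Type*} [Group G] [Finite G]
    (hG : IsNilpotent G) [MulAction G α] [FaithfulSMul G α] [Finite α]
    [MulAction.IsPretransitive G α] {p : ℕ} (hp : p.Prime) (hpG : p ∣ Nat.card G) :
    p ∣ Nat.card α := by
  by_contra hpα
  have : Fact p.Prime := ⟨hp⟩
  obtain ⟨P⟩ : Nonempty (Sylow p G) := inferInstance
  have hPn : (P : Subgroup G).Normal :=
    inferInstance
  obtain ⟨x, hx⟩ := P.isPGroup'.nonempty_fixed_point_of_prime_not_dvd_card α hpα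
  refine P.ne_bot_of_dvd_card hpG ?_
  -- A normal subgroup fixing `x` fixes every translate `h • x`, hence all of `α`.
  rw [eq_bot_iff]
  intro g hg
  refine Subgroup.mem_bot.mpr (eq_of_smul_eq_smul (α := α) fun y => ?_)
  obtain ⟨h, rfl⟩ := MulAction.exists_smul_eq G x y
  have hc : h⁻¹ * g * h ∈ (P : Subgroup G) := by simpa using hPn.conj_mem g hg h⁻¹
  have hfix : (h⁻¹ * g * h) • x = x := hx ⟨_, hc⟩
  rw [one_smul]
  simpa [mul_smul, inv_smul_eq_iff] using hfix

end Group

/-- Every prime dividing the order of the `n`-torsion of a finite abelian group divides `n`. -/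
theorem AddCommGroup.dvd_of_dvd_card_ker_nsmul {A : Type*} [AddCommGroup A] [Finite A] {n q : ℕ}
    (hq : q.Prime) (h : q ∣ Nat.card (nsmulAddMonoidHom (α := A) n).ker) : q ∣ n := by
  have : Fact q.Prime := ⟨hq⟩
  obtain ⟨a, ha⟩ := exists_prime_addOrderOf_dvd_card' q h
  rw [← ha]
  refine addOrderOf_dvd_of_nsmul_eq_zero (Subtype.ext ?_)
  exact a.2

namespace CycleSet

/-! ### The brace structure on the permutation group -/

variable {X : Type*} [CycleSet X]

theorem σ_mul_σ (x y : X) : σ (x * y) * σ x = σ (y * x) * σ y :=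
  Equiv.ext fun z => cycloid x y z

/-- Prepending a letter to a word of left multiplications. -/
noncomputable def extend (x : X) (g : Equiv.Perm X) : Equiv.Perm X := σ (g x) * g

instance : LeftCommutative (extend (X := X)) where
  left_comm x y g := by
    have h := σ_mul_σ (g y) (g x)
    simp only [extend, ← mul_assoc, Equiv.Perm.mul_apply]
    exact congrArg (· * g) h

/-- The extension of `σ` to the free commutative monoid over `X`. -/
noncomputable def permOf (m : Multiset X) : Equiv.Perm X := m.foldr extend 1

@[simp] theorem permOf_zero : permOf (0 : Multiset X) = 1 := Multiset.foldr_zero _ _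

theorem permOf_cons (x : X) (m : Multiset X) :
    permOf (x ::ₘ m) = σ (permOf m x) * permOf m := Multiset.foldr_cons _ _ _ _

theorem permOf_singleton (x : X) : permOf ({x} : Multiset X) = σ x := by
  rw [← Multiset.cons_zero, permOf_cons]; simp

/-- The cocycle identity linking addition of multisets to composition; everything below rests on it.
-/
theorem permOf_add (m n : Multiset X) :
    permOf (n + m) = permOf (n.map (permOf m)) * permOf m := by
  induction n using Multiset.induction with
  | empty => simp
  | cons x n ih =>
    rw [Multiset.cons_add, permOf_cons, ih, Multiset.map_cons, permOf_cons, mul_assoc]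
    rfl

theorem permOf_mem (m : Multiset X) : permOf m ∈ permGroup X := by
  induction m using Multiset.induction with
  | empty => simp [one_mem]
  | cons x n ih =>
    rw [permOf_cons]
    exact mul_mem (Subgroup.subset_closure ⟨_, rfl⟩) ih

/-- Multisets with the same permutation form an additive congruence. -/
def permCon (X : Type*) [CycleSet X] : AddCon (Multiset X) where
  r m n := permOf m = permOf n
  iseqv := ⟨fun _ => rfl, Eq.symm, Eq.trans⟩
  add' {m m' n n'} h h' := by
    rw [permOf_add n m, h', ← permOf_add n' m, add_comm, permOf_add, h, ← permOf_add, add_comm]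

theorem permCon_iff {m n : Multiset X} : permCon X m n ↔ permOf m = permOf n := Iff.rfl

theorem permOf_map_σ {m n : Multiset X} (x : X) (h : permOf m = permOf n) :
    permOf (m.map (σ x)) = permOf (n.map (σ x)) := by
  have h' : permOf (m + {x}) = permOf (n + {x}) := (permCon X).add h ((permCon X).refl {x})
  rw [permOf_add, permOf_add, permOf_singleton] at h'
  exact mul_right_cancel h'

/-- The additive group of the brace attached to the permutation group. -/
abbrev AddPerm (X : Type*) [CycleSet X] : Type _ := (permCon X).Quotient

/-- The bijection from the additive group onto the permutation group. -/
noncomputable def AddPerm.toPerm (a : AddPerm X) : Equiv.Perm X :=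
  AddCon.liftOn a permOf fun _ _ h => h

theorem AddPerm.toPerm_injective : Function.Injective (AddPerm.toPerm (X := X)) := by
  intro a b
  induction a, b using AddCon.induction_on₂ with
  | _ m n => exact fun h => (AddCon.eq _).mpr h

theorem permOf_nsmul_eq_one_iff {n : ℕ} {m : Multiset X} :
    permOf (n • m) = 1 ↔ n • (m : AddPerm X) = 0 := by
  have h : n • (m : AddPerm X) = ((n • m : Multiset X) : AddPerm X) :=
    (map_nsmul (permCon X).mk' n m).symm
  rw [h, ← AddCon.coe_zero, AddCon.eq, permCon_iff, permOf_zero]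

variable [Finite X]

/-- The action of 𝒢(X) descends to the additive group. By finiteness, products of the `σ x` without
inverses suffice. -/
theorem permOf_map {g : Equiv.Perm X} (hg : g ∈ permGroup X) {m n : Multiset X}
    (h : permOf m = permOf n) : permOf (m.map g) = permOf (n.map g) := by
  rw [permGroup, ← Subgroup.mem_toSubmonoid, Subgroup.closure_toSubmonoid_of_finite] at hg
  induction hg using Submonoid.closure_induction generalizing m n with
  | mem g hg => obtain ⟨x, rfl⟩ := hg; exact permOf_map_σ x h
  | one => simpa using h
  | mul a b _ _ iha ihb =>
    have := iha (ihb h)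
    simpa [Multiset.map_map] using this

instance : Finite (AddPerm X) := Finite.of_injective _ AddPerm.toPerm_injective

theorem permOf_add_left_cancel {k m n : Multiset X} (h : permOf (k + m) = permOf (k + n)) :
    permOf m = permOf n := by
  -- With `k` on the right, the cocycle factor `permOf k` cancels; its twist is then undone by its
  -- inverse.
  rw [add_comm k, add_comm k, permOf_add, permOf_add] at h
  have := permOf_map (inv_mem (permOf_mem k)) (mul_right_cancel h)
  simpa [Multiset.map_map, Function.comp_def] using this

noncomputable instance : AddLeftCancelMonoid (AddPerm X) where
  add_left_cancel a b c := by
    induction a using AddCon.induction_on with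
    | _ k =>
      induction b, c using AddCon.induction_on₂ with
      | _ m n =>
        exact fun h => (AddCon.eq _).mpr (permOf_add_left_cancel ((AddCon.eq _).mp h))

noncomputable instance : AddCommGroup (AddPerm X) :=
  { AddLeftCancelMonoid.addGroupOfFinite (G := AddPerm X) with add_comm := add_comm }

/-! ### Additive torsion as subgroups of permutations -/

theorem mul_mem_torsion (n : ℕ) {g h : Equiv.Perm X}
    (hg : ∃ m, permOf m = g ∧ permOf (n • m) = 1) (hh : ∃ m, permOf m = h ∧ permOf (n • m) = 1) :
    ∃ m, permOf m = g * h ∧ permOf (n • m) = 1 := by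
  obtain ⟨a, rfl, ha⟩ := hg
  obtain ⟨b, rfl, hb⟩ := hh
  -- Pre-twisting `a` cancels the twist in the cocycle identity.
  refine ⟨a.map ⇑(permOf b)⁻¹ + b, ?_, ?_⟩
  · rw [permOf_add]
    simp [Multiset.map_map]
  · have := permOf_map (inv_mem (permOf_mem b)) (ha.trans permOf_zero.symm)
    rw [nsmul_add, permOf_add, hb, ← Multiset.map_nsmul, mul_one]
    simpa using this

/-- The permutations `permOf m` with `n • m` trivial, that is, of additive order dividing `n`. -/
def torsionSubgroup (X : Type*) [CycleSet X] [Finite X] (n : ℕ) : Subgroup (Equiv.Perm X) where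
  carrier := {g | ∃ m, permOf m = g ∧ permOf (n • m) = 1}
  one_mem' := ⟨0, by simp⟩
  mul_mem' := mul_mem_torsion n
  inv_mem' {g} hg := by
    let S : Submonoid (Equiv.Perm X) :=
      { carrier := {g | ∃ m, permOf m = g ∧ permOf (n • m) = 1}
        one_mem' := ⟨0, by simp⟩
        mul_mem' := mul_mem_torsion n }
    -- In a finite group, inverses are positive powers.
    have h : g⁻¹ ∈ Submonoid.powers g :=
      mem_powers_iff_mem_zpowers.mpr (inv_mem (Subgroup.mem_zpowers g))
    exact (Submonoid.powers_le (P := S)).mpr hg h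

/-- A torsion subgroup has as many elements as the corresponding additive torsion subgroup. -/
theorem card_torsionSubgroup (n : ℕ) :
    Nat.card (torsionSubgroup X n) = Nat.card (nsmulAddMonoidHom (α := AddPerm X) n).ker := by
  have h : (torsionSubgroup X n : Set (Equiv.Perm X)) =
      AddPerm.toPerm '' ((nsmulAddMonoidHom (α := AddPerm X) n).ker : Set (AddPerm X)) := by
    ext g
    constructor
    · rintro ⟨m, rfl, hm⟩
      exact ⟨m, permOf_nsmul_eq_one_iff.mp hm, rfl⟩
    · rintro ⟨a, ha, rfl⟩
      induction a using AddCon.induction_on with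
      | _ m => exact ⟨m, rfl, permOf_nsmul_eq_one_iff.mpr ha⟩
  exact (congrArg Set.ncard h).trans (Set.ncard_image_of_injective _ AddPerm.toPerm_injective)

theorem dvd_of_dvd_card_torsionSubgroup {n q : ℕ} (hq : q.Prime)
    (h : q ∣ Nat.card (torsionSubgroup X n)) : q ∣ n :=
  AddCommGroup.dvd_of_dvd_card_ker_nsmul hq (card_torsionSubgroup (X := X) n ▸ h)

theorem coprime_orderOf_of_mem_torsionSubgroup {n p : ℕ} (hp : p.Prime) (hn : ¬ p ∣ n)
    {g : Equiv.Perm X} (hg : g ∈ torsionSubgroup X n) : p.Coprime (orderOf g) := by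
  rw [hp.coprime_iff_not_dvd]
  exact fun h => hn <| dvd_of_dvd_card_torsionSubgroup hp <|
    h.trans (Subgroup.orderOf_dvd_natCard _ hg)

theorem exists_pow_eq_one_of_mem_torsionSubgroup {p k : ℕ} (hp : p.Prime)
    {g : Equiv.Perm X} (hg : g ∈ torsionSubgroup X (p ^ k)) : ∃ j, g ^ p ^ j = 1 := by
  have hc : Nat.card (torsionSubgroup X (p ^ k)) ≠ 0 := Nat.card_pos.ne'
  have h := Nat.eq_prime_pow_of_unique_prime_dvd hc fun {q} hq hd =>
    (Nat.prime_dvd_prime_iff_eq hq hp).mp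
      (hq.dvd_of_dvd_pow (dvd_of_dvd_card_torsionSubgroup hq hd))
  exact ⟨_, orderOf_dvd_iff_pow_eq_one.mp (h ▸ Subgroup.orderOf_dvd_natCard _ hg)⟩

/-- Torsion of coprime exponents splits off additively. -/
theorem exists_add_of_coprime {r s : ℕ} (hrs : r.Coprime s)
    (hcard : Nat.card (AddPerm X) = r * s) (m : Multiset X) :
    ∃ m₁ m₂ : Multiset X, permOf (m₁ + m₂) = permOf m ∧
      permOf (r • m₁) = 1 ∧ permOf (s • m₂) = 1 := by
  have h0 : (r * s) • (m : AddPerm X) = 0 := hcard ▸ card_nsmul_eq_zero'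
  obtain ⟨u, v, huv⟩ := Nat.isCoprime_iff_coprime.mpr hrs
  obtain ⟨m₁, h₁⟩ := AddCon.mk'_surjective (v • s • (m : AddPerm X))
  obtain ⟨m₂, h₂⟩ := AddCon.mk'_surjective (u • r • (m : AddPerm X))
  replace h₁ : (m₁ : AddPerm X) = v • s • (m : AddPerm X) := h₁
  replace h₂ : (m₂ : AddPerm X) = u • r • (m : AddPerm X) := h₂
  refine ⟨m₁, m₂, ?_, ?_, ?_⟩
  · rw [← permCon_iff, ← AddCon.eq, AddCon.coe_add, h₁, h₂, ← natCast_zsmul, ← natCast_zsmul,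
      smul_smul, smul_smul, ← add_smul, add_comm, huv, one_smul]
  · rw [permOf_nsmul_eq_one_iff, h₁, smul_comm, smul_smul, h0, smul_zero]
  · rw [permOf_nsmul_eq_one_iff, h₂, smul_comm, smul_smul, mul_comm, h0, smul_zero]

/-- If the permutation group is nilpotent and `X` is indecomposable, each prime dividing
the order of the permutation group divides the order of every left multiplication. -/
theorem dvd_orderOf_σ (hnil : Group.IsNilpotent (permGroup X)) (hX : IsIndecomposable X) {p : ℕ}
    (hp : p.Prime) (hpG : p ∣ Nat.card (permGroup X)) (x : X) : p ∣ orderOf (σ x) := by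
  by_contra hpx
  obtain ⟨k, s, hs, hcard⟩ :=
    Nat.exists_eq_pow_mul_and_not_dvd (Nat.card_pos (α := AddPerm X)).ne' p hp.ne_one
  have hps : (p ^ k).Coprime s := ((hp.coprime_iff_not_dvd).mpr hs).pow_left k
  obtain ⟨m₁, m₂, hm, h₁, h₂⟩ := exists_add_of_coprime hps hcard {x}
  have hmem : permOf (m₁.map (permOf m₂)) ∈ torsionSubgroup X (p ^ k) :=
    ⟨_, rfl, by
      rw [← Multiset.map_nsmul, permOf_map (permOf_mem m₂) (h₁.trans permOf_zero.symm)]; simp⟩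
  obtain ⟨j, hj⟩ := exists_pow_eq_one_of_mem_torsionSubgroup hp hmem
  have hm₂ : permOf m₂ ∈ torsionSubgroup X s := ⟨m₂, rfl, h₂⟩
  -- Here `σ x = b * a`, with `b` a `p`-element and `a`, `b * a` of order prime to `p`.
  have hb : permOf (m₁.map (permOf m₂)) = 1 := by
    have := Group.eq_one_of_isNilpotent_of_coprime_orderOf hnil hp
      (b := ⟨_, permOf_mem (m₁.map (permOf m₂))⟩) (a := ⟨_, permOf_mem m₂⟩) (k := j)
      (Subtype.ext hj)
      (by
        rw [Subgroup.orderOf_mk]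
        exact coprime_orderOf_of_mem_torsionSubgroup hp hs hm₂)
      (by
        rw [MulMemClass.mk_mul_mk, Subgroup.orderOf_mk, ← permOf_add, hm, permOf_singleton]
        exact (hp.coprime_iff_not_dvd).mpr hpx)
    exact congrArg Subtype.val this
  have hx : permOf (s • ({x} : Multiset X)) = 1 := by
    have he : permOf ({x} : Multiset X) = permOf m₂ := by rw [← hm, permOf_add, hb, one_mul]
    rw [permOf_nsmul_eq_one_iff, (AddCon.eq (permCon X)).mpr he, ← permOf_nsmul_eq_one_iff, h₂]
  -- Transitivity carries the `s`-torsion of `x` to every `y`.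
  have hle : permGroup X ≤ torsionSubgroup X s := by
    rw [permGroup, Subgroup.closure_le]
    rintro _ ⟨y, rfl⟩
    obtain ⟨⟨g, hg⟩, hgx⟩ := hX.exists_smul_eq x y
    refine ⟨{y}, permOf_singleton y, ?_⟩
    have := permOf_map hg (hx.trans permOf_zero.symm)
    rw [Multiset.map_nsmul, Multiset.map_singleton] at this
    simpa [show g x = y from hgx] using this
  exact hs (dvd_of_dvd_card_torsionSubgroup hp (hpG.trans (Subgroup.card_dvd_of_le hle)))

end CycleSet

theorem mainTheorem8 {X : Type*} [CycleSet X] [Finite X]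
    (hnd : CycleSet.IsNondegenerate X)
    (hnil : Group.IsNilpotent (CycleSet.permGroup X)) :
    (CycleSet.IsIndecomposable X → ∀ x : X,
      (orderOf (CycleSet.σ x)).primeFactors = (Nat.card X).primeFactors ∧
      (Nat.card X).primeFactors = (Nat.card (CycleSet.permGroup X)).primeFactors) ∧
    ((∃ x : X,
      (orderOf (CycleSet.σ x)).primeFactors ≠ (Nat.card X).primeFactors ∨
      (orderOf (CycleSet.σ x)).primeFactors ≠
        (Nat.card (CycleSet.permGroup X)).primeFactors) →
      CycleSet.IsDecomposable X) := by
  have key : CycleSet.IsIndecomposable X → ∀ x : X,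
      (orderOf (CycleSet.σ x)).primeFactors = (Nat.card X).primeFactors ∧
      (Nat.card X).primeFactors = (Nat.card (CycleSet.permGroup X)).primeFactors := by
    intro hX x
    have : MulAction.IsPretransitive (CycleSet.permGroup X) X := hX
    have : Nonempty X := ⟨x⟩
    have hG : Nat.card (CycleSet.permGroup X) ≠ 0 := Nat.card_pos.ne'
    have hXG : (Nat.card X).primeFactors = (Nat.card (CycleSet.permGroup X)).primeFactors := by
      refine (Nat.primeFactors_mono ?_ hG).antisymm fun p hp => ?_
      · rw [← MulAction.index_stabilizer_of_transitive (CycleSet.permGroup X) x]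
        exact Subgroup.index_dvd_card _
      · have hp' := Nat.prime_of_mem_primeFactors hp
        exact Nat.mem_primeFactors.mpr ⟨hp', Group.dvd_card_of_isNilpotent_of_isPretransitive hnil
          hp' (Nat.dvd_of_mem_primeFactors hp), Nat.card_pos.ne'⟩
    refine ⟨Eq.trans ?_ hXG.symm, hXG⟩
    refine (Nat.primeFactors_mono ?_ hG).antisymm fun p hp => ?_
    · exact Subgroup.orderOf_dvd_natCard _ (Subgroup.subset_closure ⟨x, rfl⟩)
    · have hp' := Nat.prime_of_mem_primeFactors hp
      exact Nat.mem_primeFactors.mpr ⟨hp', CycleSet.dvd_orderOf_σ hnil hX hp'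
        (Nat.dvd_of_mem_primeFactors hp) x, (orderOf_pos _).ne'⟩
  refine ⟨key, ?_⟩
  rintro ⟨x, h⟩ hX
  obtain ⟨h₁, h₂⟩ := key hX x
  exact h.elim (· h₁) (· (h₁.trans h₂))
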